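/- **Proposition.** Let $G$ be a sofic group and let $T=\sum_{g}a_g\,g\in\mathbb{Q}G$ be an element which, acting on $\ell^2G$ by left translations ($g\cdot\zeta_h=\zeta_{gh}$), is a positive self-adjoint operator, and for which $\sum_{g}|a_g|<1$. Let $C$ be the least common multiple of the denominators of the coefficients $a_g$ (in lowest terms). For a bounded operator $A$ on $\ell^2G$ write $\operatorname{tr}_{vN}(A)=\langle A\zeta_e,\zeta_e\rangle$, and let $\mu_T$ be the spectral measure of $T$ with respect to $\operatorname{tr}_{vN}$, i.e. the Borel measure on $\mathbb{R}$ with $\mu_T(B)=\operatorname{tr}_{vN}(\mathbf 1_B(T))$, so that $\mu_T(\{0\})$ is the von Neumann dimension of $\ker T$. Then for every integer $n\ge 2$ $$\bigl|\operatorname{tr}_{vN}\bigl((1-T)^n\bigr)-\mu_T(\{0\})\bigr|<\frac{3\,C}{\log n}.$$ Here a group is sofic if it is finitely generated and for a finite symmetric generating sequence $(g_1,\dots,g_m)$, every $\varepsilon>0$ and every $R$ there is an $(\varepsilon,R)$-sofic approximation, or if it is not finitely generated and all its finitely generated subgroups are sofic. An $(\varepsilon,R)$-sofic approximation is a finite non-empty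 oriented graph $K$ with edges labelled by the $g_i$ such that each label occurs at most once on the edges leaving, and at most once on the edges entering, a given vertex; the edges from $v$ to $w$ whose label has value $x$ are as many as the edges from $w$ to $v$ whose label has value $x^{-1}$; and for at least $(1-\varepsilon)|V(K)|$ vertices $v$ the ball of radius $R$ at $v$ is isomorphic, as a rooted oriented labelled graph, to the ball of radius $R$ at $e$ in the Cayley diagram (an edge labelled $g_i$ from $a$ to $ag_i$). -/

import Mathlib

open MeasureTheory
open scoped CompactlySupported ENNReal InnerProductSpace

/-! ## Sofic groups -/

namespace SoficGroup

variable {ι : Type*} {V : Type*} {W : Type*}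

/-- An oriented graph on `V` whose edges carry labels in `ι` is given by `E : ι → V → V → Prop`,
where `E i v w` says that there is an edge with label `i` from `v` to `w`.
`Within E R v w` says that the distance from `v` to `w` in the underlying unoriented graph
is at most `R`. -/
def Within (E : ι → V → V → Prop) : ℕ → V → V → Prop
  | 0, v, w => v = w
  | R + 1, v, w => Within E R v w ∨ ∃ u, Within E R v u ∧ ∃ i, E i u w ∨ E i w u

/-- The vertex set of the ball of radius `R` at `v`. -/
def ball (E : ι → V → V → Prop) (v : V) (R : ℕ) : Set V :=
  {w | Within E R v w}

/-- The ball of radius `R` at `v` in the graph `E` is isomorphic to the ball of radius `R` at `v'`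
in the graph `E'`, as a rooted oriented labelled graph (balls are induced subgraphs). -/
def BallIso (E : ι → V → V → Prop) (v : V) (E' : ι → W → W → Prop) (v' : W) (R : ℕ) : Prop :=
  ∃ f : V → W, f v = v' ∧ Set.BijOn f (ball E v R) (ball E' v' R) ∧
    ∀ i, ∀ a ∈ ball E v R, ∀ b ∈ ball E v R, (E i a b ↔ E' i (f a) (f b))

variable {G : Type*} [Group G]

/-- The Cayley diagram of a sequence `g` of elements of `G`: there is an edge with label `i`
from `a` to `b` iff `a * g i = b`. -/
def cayley (g : ι → G) : ι → G → G → Prop :=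
  fun i a b => a * g i = b

/-- The sequence `g` is symmetric: every element of `G` appears in it as often as its inverse. -/
def IsSymmetricSeq (g : ι → G) : Prop :=
  ∀ x : G, {i | g i = x}.ncard = {i | g i = x⁻¹}.ncard

/-- The graphs, labelled by the members of the sequence `g`, that may serve as approximations:
every label occurs at most once on the edges leaving a given vertex and at most once on the edges
entering it (so that all degrees are at most the length of the sequence), and there are as many
edges from `v` to `w` whose label has the value `x` as there are edges from `w` to `v` whose label
has the value `x⁻¹`. -/
structure IsAdmissible (g : ι → G) (E : ι → V → V → Prop) : Prop where
  out_unique : ∀ i v w w', E i v w → E i v w' → w = w'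
  in_unique : ∀ i v v' w, E i v w → E i v' w → v = v'
  symm : ∀ (x : G) (v w : V),
    {i | g i = x ∧ E i v w}.ncard = {i | g i = x⁻¹ ∧ E i w v}.ncard

/-- The finite graph `E` is an `(ε, R)`-sofic approximation with respect to the sequence `g`. -/
def IsSoficApproximation (g : ι → G) (E : ι → V → V → Prop) (ε : ℝ) (R : ℕ) : Prop :=
  IsAdmissible g E ∧
    (1 - ε) * (Nat.card V : ℝ) ≤ ({v : V | BallIso E v (cayley g) 1 R}.ncard : ℝ)

/-- The finitely generated group `G` is sofic: for a finite symmetric generating sequence there are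
`(ε, R)`-sofic approximations (finite and non-empty) for all `ε > 0` and all `R`. -/
def IsSoficFG (G : Type*) [Group G] : Prop :=
  ∃ (m : ℕ) (g : Fin m → G), IsSymmetricSeq g ∧ Subgroup.closure (Set.range g) = ⊤ ∧
    ∀ ε : ℝ, 0 < ε → ∀ R : ℕ,
      ∃ (V : Type) (_ : Finite V) (_ : Nonempty V) (E : Fin m → V → V → Prop),
        IsSoficApproximation g E ε R

end SoficGroup

/-- Sofic groups: a group that is not finitely generated is sofic iff all its finitely generated
subgroups are. -/
def IsSofic (G : Type*) [Group G] : Prop :=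
  (Group.FG G ∧ SoficGroup.IsSoficFG G) ∨
    (¬ Group.FG G ∧ ∀ H : Subgroup G, H.FG → SoficGroup.IsSoficFG H)

/-! ## Spectral measures of bounded self-adjoint operators -/

section SpectralMeasure

variable {H : Type*} [NormedAddCommGroup H] [InnerProductSpace ℂ H] [CompleteSpace H]

/-- The positive linear functional `f ↦ ⟪f(T) ξ, ξ⟫` on the continuous functions on the spectrum
of the self-adjoint operator `T`, where `f(T)` is the continuous functional calculus. -/
noncomputable def spectralFunctional (T : H →L[ℂ] H) (hT : IsSelfAdjoint T) (ξ : H) :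
    C_c(spectrum ℝ T, ℝ) →ₚ[ℝ] ℝ :=
  PositiveLinearMap.mk₀
    { toFun := fun f => (⟪ξ, cfcHom hT f.toContinuousMap ξ⟫_ℂ).re
      map_add' := fun f g => by
        have h : (f + g).toContinuousMap = f.toContinuousMap + g.toContinuousMap := rfl
        rw [h, map_add, add_apply, inner_add_right, Complex.add_re]
      map_smul' := fun c f => by
        have h : (c • f).toContinuousMap = c • f.toContinuousMap := rfl
        rw [h, map_smul, smul_apply, inner_smul_right_eq_smul,
          Complex.smul_re, RingHom.id_apply] }
    (fun f hf => by
      set s : C(spectrum ℝ T, ℝ) := ⟨fun x => Real.sqrt (f x), by fun_prop⟩ with hs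
      have h : f.toContinuousMap = star s * s := by
        ext x
        simpa [hs] using (Real.mul_self_sqrt (hf x)).symm
      change 0 ≤ (⟪ξ, cfcHom hT f.toContinuousMap ξ⟫_ℂ).re
      rw [h, map_mul, map_star, mul_apply_eq_comp, ContinuousLinearMap.star_eq_adjoint,
        ContinuousLinearMap.adjoint_inner_right]
      exact inner_self_nonneg (𝕜 := ℂ))

/-- The spectral measure of the bounded self-adjoint operator `T` at the vector `ξ`, i.e. the
measure `B ↦ ⟪1_B(T) ξ, ξ⟫` on `ℝ`: the Borel measure on the spectrum of `T` that represents
`f ↦ ⟪f(T) ξ, ξ⟫`, viewed as a measure on `ℝ`. -/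
noncomputable def spectralMeasure (T : H →L[ℂ] H) (hT : IsSelfAdjoint T) (ξ : H) : Measure ℝ :=
  (RealRMK.rieszMeasure (spectralFunctional T hT ξ)).map Subtype.val

end SpectralMeasure

/-! ## The group ring acting on `ℓ²(G)`, the von Neumann trace -/

section GroupRing

variable {G : Type*} [Group G]

/-- The Hilbert space `ℓ²(G)`. -/
abbrev L2 (G : Type*) : Type _ := lp (fun _ : G => ℂ) 2

/-- Left translation by `g` on `ℓ²(G)`: `(g • f)(h) = f(g⁻¹ h)`, so that `g • ζ_h = ζ_{gh}`. -/
noncomputable def leftTranslation (g : G) : L2 G →ₗᵢ[ℂ] L2 G where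
  toFun f := ⟨fun h => f (g⁻¹ * h), by
    have hf := (memℓp_gen_iff (p := 2) (by norm_num)).1 (lp.memℓp f)
    exact memℓp_gen ((Equiv.mulLeft g⁻¹).summable_iff.2 hf)⟩
  map_add' _ _ := rfl
  map_smul' _ _ := rfl
  norm_map' f := by
    change ‖(⟨fun h => f (g⁻¹ * h), _⟩ : L2 G)‖ = ‖f‖
    rw [lp.norm_eq_tsum_rpow (by norm_num), lp.norm_eq_tsum_rpow (by norm_num)]
    congr 1
    exact (Equiv.mulLeft g⁻¹).tsum_eq (fun h => ‖f h‖ ^ (2 : ℝ≥0∞).toReal)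

/-- The left regular representation of `G` by bounded operators on `ℓ²(G)`. -/
noncomputable def leftRegular (G : Type*) [Group G] : G →* (L2 G →L[ℂ] L2 G) where
  toFun g := (leftTranslation g).toContinuousLinearMap
  map_one' := by
    ext f h
    change f (1⁻¹ * h) = f h
    simp
  map_mul' a b := by
    ext f h
    change f ((a * b)⁻¹ * h) = f (b⁻¹ * (a⁻¹ * h))
    simp [mul_assoc]

/-- The bounded operator on `ℓ²(G)` given by an element of the complex group ring. -/
noncomputable def groupRingOp (G : Type*) [Group G] :
    MonoidAlgebra ℂ G →ₐ[ℂ] (L2 G →L[ℂ] L2 G) :=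
  MonoidAlgebra.lift ℂ (L2 G →L[ℂ] L2 G) G (leftRegular G)

/-- The bounded operator on `ℓ²(G)` given by an element of the rational group ring. -/
noncomputable def ratGroupRingOp (T : MonoidAlgebra ℚ G) : L2 G →L[ℂ] L2 G :=
  groupRingOp G (MonoidAlgebra.mapRingHom G (algebraMap ℚ ℂ) T)

open Classical in
/-- The basis vector `ζ_e` of `ℓ²(G)`, where `e` is the neutral element. -/
noncomputable def zetaOne (G : Type*) [Group G] : L2 G :=
  lp.single 2 (1 : G) (1 : ℂ)

/-- The von Neumann trace `⟨A ζ_e, ζ_e⟩` (Mathlib's inner product is linear in the second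
argument). -/
noncomputable def vnTrace (A : L2 G →L[ℂ] L2 G) : ℂ :=
  ⟪zetaOne G, A (zetaOne G)⟫_ℂ

/-- The spectral measure `μ_A` of a self-adjoint operator on `ℓ²(G)` with respect to the von Neumann
trace, `μ_A(B) = tr_vN(1_B(A))`. -/
noncomputable def vnSpectralMeasure (A : L2 G →L[ℂ] L2 G) (hA : IsSelfAdjoint A) : Measure ℝ :=
  spectralMeasure A hA (zetaOne G)

/-- The least common multiple of the denominators of the coefficients of `T` (it is `1` for
`T = 0`). -/
def lcmDenominators (T : MonoidAlgebra ℚ G) : ℕ :=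
  T.coeff.support.lcm fun g => (T.coeff g).den

end GroupRing

/-!
Write `μ` for the spectral measure of `T`. As `T` is positive of norm less than `1`, `μ` lives on
`[0, 1]`, so the quantity to be bounded is `∫ (1 - x) ^ n dμ - μ {0}`, which is non-negative and at
most `∫ (1 - x ^ 2) ^ n dμ - μ {0}`. The last expression is the limit, as `k → ∞`, of
`∫ (1 - x ^ 2) ^ n - (1 - x ^ 2) ^ k dμ`, which is the coefficient at `1` of the group ring element
`(1 - T ^ 2) ^ n - (1 - T ^ 2) ^ k`. Working with these polynomials in `T ^ 2` makes any weak
convergence of measures unnecessary: only finitely many coefficients have to be approximated.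

A sofic group has approximations by permutations of finite sets `V`
(`IsSofic.exists_hasPermApprox`): the partial injections given by the labels of a sofic
approximation extend to permutations, and at a vertex whose ball is that of the Cayley diagram a
short word fixes the vertex iff its value in the group is trivial. Hence, lifting `T` to the free
group and letting the free group act on `V` by permutation matrices, the coefficient above is the
limit of the normalised traces of `(1 - Aᵀ A) ^ n - (1 - Aᵀ A) ^ k`, where `A` is the matrix of the
lift (`HasPermApprox.exists_coeff_one_le`). The self-adjointness of `T` enters only in that the
adjoint of the lift is again a lift of `T`; the matrix `A` itself need not be symmetric.

Finally `A` is a contraction and `C A` has integer entries, so the product of the non-zero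
eigenvalues of `C² Aᵀ A` is a positive integer. So for `0 < η < 1` at most
`2 log C / log (1 / η) * |V|` eigenvalues of `Aᵀ A` lie in `(0, η]`, and the normalised trace is at
most `2 log C / log (1 / η) + (1 - η) ^ n`
(`Matrix.trace_one_sub_transpose_mul_pow_sub_le`). For `η = n ^ (-2 / 3)` this is less than
`3 C / log n`.
-/

/-! ### Eigenvalues of integer matrices -/

/-- The product of the non-zero eigenvalues of a real symmetric matrix is, up to sign, the trailing
coefficient of its characteristic polynomial. -/
theorem Matrix.IsHermitian.abs_trailingCoeff_charpoly {V : Type*} [Fintype V] [DecidableEq V]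
    {A : Matrix V V ℝ} (hA : A.IsHermitian) :
    |A.charpoly.trailingCoeff| =
      ∏ i, if hA.eigenvalues i = 0 then 1 else |hA.eigenvalues i| := by
  have hmul : ∀ s : Finset V, |(∏ i ∈ s, (Polynomial.X -
      Polynomial.C (hA.eigenvalues i))).trailingCoeff| =
      ∏ i ∈ s, if hA.eigenvalues i = 0 then 1 else |hA.eigenvalues i| := by
    intro s
    induction s using Finset.induction_on with
    | empty =>
      rw [Finset.prod_empty, Finset.prod_empty,
        Polynomial.trailingCoeff_eq_coeff_zero (by simp)]
      simp
    | insert a s ha ih =>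
      rw [Finset.prod_insert ha, Finset.prod_insert ha, Polynomial.trailingCoeff_mul, abs_mul, ih]
      congr 1
      split_ifs with h
      · rw [h, map_zero, sub_zero, Polynomial.trailingCoeff,
          Polynomial.natTrailingDegree_X]
        simp
      · rw [Polynomial.trailingCoeff_eq_coeff_zero (by simpa using h)]
        simp
  have h := hA.charpoly_eq
  simp only [RCLike.ofReal_real_eq_id, id_eq] at h
  rw [h]
  exact hmul _

/-- For a symmetric matrix with integer entries, the product of the absolute values of the non-zero
eigenvalues is a non-zero integer, hence at least `1`. -/
theorem Matrix.IsHermitian.one_le_prod_nonzero_eigenvalues {V : Type*} [Fintype V] [DecidableEq V]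
    {Z : Matrix V V ℤ} (hA : (Z.map (Int.cast : ℤ → ℝ)).IsHermitian) :
    1 ≤ ∏ i, if hA.eigenvalues i = 0 then (1 : ℝ) else |hA.eigenvalues i| := by
  rw [← hA.abs_trailingCoeff_charpoly]
  have h : (Z.map (Int.cast : ℤ → ℝ)).charpoly = Z.charpoly.map (Int.castRingHom ℝ) :=
    Matrix.charpoly_map Z (Int.castRingHom ℝ)
  have hne : (Z.map (Int.cast : ℤ → ℝ)).charpoly.trailingCoeff ≠ 0 := by
    rw [Polynomial.trailingCoeff_nonzero_iff_nonzero]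
    exact (Matrix.charpoly_monic _).ne_zero
  rw [h, Polynomial.trailingCoeff, Polynomial.coeff_map] at hne ⊢
  simp only [eq_intCast] at hne ⊢
  exact_mod_cast Int.one_le_abs (by exact_mod_cast hne)

/-- The trace of a power of `1 - M`, for `M` symmetric, in terms of the eigenvalues of `M`. -/
theorem Matrix.IsHermitian.trace_one_sub_smul_pow {V : Type*} [Fintype V] [DecidableEq V]
    {M : Matrix V V ℝ} (hM : M.IsHermitian) (c : ℝ) (k : ℕ) :
    ((1 - c • M) ^ k).trace = ∑ i, (1 - c * hM.eigenvalues i) ^ k := by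
  set e := Unitary.conjStarAlgAut ℝ (Matrix V V ℝ) hM.eigenvectorUnitary
  have h : (1 - c • M) ^ k = e (Matrix.diagonal fun i => (1 - c * hM.eigenvalues i) ^ k) := by
    have hd : (Matrix.diagonal fun i => (1 - c * hM.eigenvalues i) ^ k) =
        (1 - c • Matrix.diagonal (RCLike.ofReal ∘ hM.eigenvalues : V → ℝ)) ^ k := by
      have : (1 - c • Matrix.diagonal (RCLike.ofReal ∘ hM.eigenvalues : V → ℝ)) =
          Matrix.diagonal fun i => (1 - c * hM.eigenvalues i) := by
        rw [← Matrix.diagonal_one, ← Matrix.diagonal_smul, Matrix.diagonal_sub]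
        rfl
      rw [this, Matrix.diagonal_pow]
      rfl
    rw [hd, map_pow, map_sub, map_one, map_smul, ← hM.spectral_theorem]
  rw [h, Unitary.conjStarAlgAut_apply, Matrix.trace_mul_comm, ← mul_assoc, Unitary.coe_star_mul_self,
    one_mul, Matrix.trace_diagonal]

/-- The pointwise inequality behind the count of small eigenvalues: on `(0, η]` the quotient of
logarithms is at least `1`, on `[η, 1]` it is non-negative. -/
theorem one_sub_pow_le_log_div_add {η θ : ℝ} (hη : 0 < η) (hη1 : η < 1) (hθ : 0 < θ) (hθ1 : θ ≤ 1)
    (n : ℕ) : (1 - θ) ^ n ≤ Real.log θ / Real.log η + (1 - η) ^ n := by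
  have hlη : Real.log η < 0 := Real.log_neg hη hη1
  rcases le_total θ η with h | h
  · have h1 : 1 ≤ Real.log θ / Real.log η := by
      rw [one_le_div_of_neg hlη]
      exact Real.log_le_log hθ h
    have h2 : (1 - θ) ^ n ≤ 1 := pow_le_one₀ (by linarith) (by linarith)
    have h3 : 0 ≤ (1 - η) ^ n := pow_nonneg (by linarith) n
    linarith
  · have h1 : 0 ≤ Real.log θ / Real.log η :=
      div_nonneg_of_nonpos (Real.log_nonpos hθ.le hθ1) hlη.le
    have h2 : (1 - θ) ^ n ≤ (1 - η) ^ n := pow_le_pow_left₀ (by linarith) (by linarith) n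
    linarith

open scoped Matrix Matrix.Norms.L2Operator in
/-- Uniform control of the small singular values of a contraction `C⁻¹ Z` with `Z` an integer
matrix: as the non-zero eigenvalues of `Zᵀ Z` have product at least `1`, few of those of
`C⁻² Zᵀ Z` are small. -/
theorem Matrix.trace_one_sub_transpose_mul_pow_sub_le {V : Type*} [Fintype V] [DecidableEq V]
    (Z : Matrix V V ℤ) {C : ℝ} (hC : 1 ≤ C) {A : Matrix V V ℝ}
    (hA : A = C⁻¹ • Z.map (Int.cast : ℤ → ℝ)) (hnorm : ‖A‖ ≤ 1)
    {η : ℝ} (hη : 0 < η) (hη1 : η < 1) (n k : ℕ) :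
    ((1 - Aᵀ * A) ^ n - (1 - Aᵀ * A) ^ k).trace ≤
      Fintype.card V * (-2 * Real.log C / Real.log η + (1 - η) ^ n) := by
  set Y : Matrix V V ℝ := (Zᵀ * Z).map (Int.cast : ℤ → ℝ) with hY
  have hY' : Y = (Z.map (Int.cast : ℤ → ℝ))ᴴ * Z.map (Int.cast : ℤ → ℝ) := by
    rw [hY, Matrix.conjTranspose_eq_transpose_of_trivial, ← Matrix.transpose_map]
    exact Matrix.map_mul (f := Int.castRingHom ℝ)
  have hYp : Y.PosSemidef := by rw [hY']; exact Matrix.posSemidef_conjTranspose_mul_self _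
  have hYh : Y.IsHermitian := hYp.1
  have hC0 : 0 < C := by linarith
  have hAA : Aᵀ * A = (C⁻¹ ^ 2) • Y := by
    rw [hA, hY', Matrix.conjTranspose_eq_transpose_of_trivial, Matrix.transpose_smul,
      Matrix.smul_mul, Matrix.mul_smul, smul_smul, sq]
  have hle : ∀ i, C⁻¹ ^ 2 * hYh.eigenvalues i ≤ 1 := by
    intro i
    have : Nonempty V := ⟨i⟩
    have h1 : C⁻¹ ^ 2 * hYh.eigenvalues i ∈ spectrum ℝ (Aᵀ * A) := by
      rw [hAA]
      exact spectrum.smul_mem_smul_iff (r := Units.mk0 (C⁻¹ ^ 2) (by positivity)) |>.2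
        (hYh.eigenvalues_mem_spectrum_real i)
    have h2 := spectrum.norm_le_norm_of_mem h1
    have h3 : ‖Aᵀ * A‖ = ‖A‖ * ‖A‖ := by
      rw [← Matrix.conjTranspose_eq_transpose_of_trivial]
      exact Matrix.l2_opNorm_conjTranspose_mul_self A
    rw [h3] at h2
    calc _ ≤ _ := Real.le_norm_self _
      _ ≤ _ := h2
      _ ≤ 1 := mul_le_one₀ hnorm (norm_nonneg _) hnorm
  have hlη : Real.log η < 0 := Real.log_neg hη hη1
  have hlC : 0 ≤ Real.log C := Real.log_nonneg hC
  rw [Matrix.trace_sub, hAA, hYh.trace_one_sub_smul_pow, hYh.trace_one_sub_smul_pow,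
    ← Finset.sum_sub_distrib]
  set θ := hYh.eigenvalues with hθ
  have hprod := Matrix.IsHermitian.one_le_prod_nonzero_eigenvalues hYh
  have hlog : 0 ≤ ∑ i, (if θ i = 0 then 0 else Real.log (θ i)) := by
    have h := Real.log_nonneg hprod
    rw [Real.log_prod (fun i _ => by split_ifs <;> simp_all)] at h
    refine h.trans_eq (Finset.sum_congr rfl fun i _ => ?_)
    split_ifs <;> simp [hθ]
  have hterm : ∀ i, (1 - C⁻¹ ^ 2 * θ i) ^ n - (1 - C⁻¹ ^ 2 * θ i) ^ k ≤
      (if θ i = 0 then 0 else Real.log (θ i)) / Real.log η +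
        (-2 * Real.log C / Real.log η + (1 - η) ^ n) := by
    intro i
    have hk : 0 ≤ (1 - C⁻¹ ^ 2 * θ i) ^ k := pow_nonneg (by linarith [hle i]) k
    split_ifs with h0
    · have h1 : 0 ≤ -2 * Real.log C / Real.log η :=
        div_nonneg_of_nonpos (by linarith) hlη.le
      have h2 : 0 ≤ (1 - η) ^ n := pow_nonneg (by linarith) n
      simp only [h0]
      simp only [mul_zero, sub_zero, one_pow, sub_self, zero_div]
      linarith
    · have hpos : 0 < θ i := lt_of_le_of_ne (hYp.eigenvalues_nonneg i) (Ne.symm h0)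
      have h1 := one_sub_pow_le_log_div_add hη hη1 (θ := C⁻¹ ^ 2 * θ i)
        (by positivity) (hle i) n
      rw [Real.log_mul (by positivity) h0, Real.log_pow, Real.log_inv, add_div] at h1
      push_cast at h1
      have h2 : 2 * -Real.log C / Real.log η = -2 * Real.log C / Real.log η := by ring
      linarith
  calc _ ≤ _ := Finset.sum_le_sum fun i _ => hterm i
    _ = (∑ i, if θ i = 0 then 0 else Real.log (θ i)) / Real.log η +
        Fintype.card V * (-2 * Real.log C / Real.log η + (1 - η) ^ n) := by
      rw [Finset.sum_add_distrib, Finset.sum_div, Finset.sum_const, Finset.card_univ,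
        nsmul_eq_mul]
    _ ≤ _ := by
      have := div_nonpos_of_nonneg_of_nonpos hlog hlη.le
      linarith

/-! ### Sofic approximations by permutations -/

/-- A partial injection of a finite set into itself extends to a permutation. -/
theorem exists_perm_extending {V : Type*} [Finite V] (r : V → V → Prop)
    (hout : ∀ v w w', r v w → r v w' → w = w') (hin : ∀ v v' w, r v w → r v' w → v = v') :
    ∃ σ : Equiv.Perm V, ∀ v w, r v w → σ v = w := by
  classical
  have := Fintype.ofFinite V
  let e : {v // ∃ w, r v w} ≃ {w // ∃ v, r v w} := Equiv.ofBijective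
    (fun v => ⟨v.2.choose, v.1, v.2.choose_spec⟩) (by
      constructor
      · rintro ⟨v, hv⟩ ⟨v', hv'⟩ h
        have h' : hv.choose = hv'.choose := congrArg Subtype.val h
        exact Subtype.ext (hin _ _ _ hv.choose_spec (h' ▸ hv'.choose_spec))
      · rintro ⟨w, v, h⟩
        have hv : ∃ w, r v w := ⟨w, h⟩
        exact ⟨⟨v, hv⟩, Subtype.ext (hout _ _ _ hv.choose_spec h)⟩)
  refine ⟨e.extendSubtype, fun v w h => ?_⟩
  have hv : ∃ w, r v w := ⟨w, h⟩
  rw [e.extendSubtype_apply_of_mem v hv]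
  exact hout _ _ _ hv.choose_spec h

namespace SoficGroup

variable {ι V W : Type*}

theorem ball_mono (E : ι → V → V → Prop) (v : V) {r s : ℕ} (h : r ≤ s) :
    ball E v r ⊆ ball E v s := by
  induction s, h using Nat.le_induction with
  | base => exact subset_rfl
  | succ s _ ih => exact fun w hw => Or.inl (ih hw)

theorem self_mem_ball (E : ι → V → V → Prop) (v : V) (r : ℕ) : v ∈ ball E v r :=
  ball_mono E v (Nat.zero_le r) (show v = v from rfl)

variable {G : Type*} [Group G]

/-- Let `σ i` be permutations extending the label relations of `E`, and let words in the labels act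
on the vertices, a generator `i` acting by `(σ i)⁻¹`. On the part of a ball isomorphic to a ball in
the Cayley diagram which is far enough from its boundary, a word acts by right multiplication with
the inverse of its value. -/
theorem exists_radius_word_action (g : ι → G) (w : FreeGroup ι) :
    ∃ r : ℕ, ∀ (V : Type) (E : ι → V → V → Prop) (σ : ι → Equiv.Perm V)
      (_ : ∀ i a b, E i a b → σ i a = b) (v : V) (R : ℕ) (f : V → G)
      (_ : Set.BijOn f (ball E v R) (ball (cayley g) 1 R))
      (_ : ∀ i, ∀ a ∈ ball E v R, ∀ b ∈ ball E v R, (E i a b ↔ cayley g i (f a) (f b)))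
      (s : ℕ) (_ : s + r ≤ R) (u : V), u ∈ ball E v s → f u ∈ ball (cayley g) 1 s →
        FreeGroup.lift (fun i => (σ i)⁻¹) w u ∈ ball E v (s + r) ∧
        f (FreeGroup.lift (fun i => (σ i)⁻¹) w u) ∈ ball (cayley g) 1 (s + r) ∧
        f (FreeGroup.lift (fun i => (σ i)⁻¹) w u) = f u * (FreeGroup.lift g w)⁻¹ := by
  induction w using FreeGroup.induction_on with
  | C1 => exact ⟨0, fun V E σ hσ v R f hf hE s hs u hu hfu => by simpa using ⟨hu, hfu⟩⟩
  | of i =>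
    refine ⟨1, fun V E σ hσ v R f hf hE s hs u hu hfu => ?_⟩
    have hx : f u * (g i)⁻¹ ∈ ball (cayley g) 1 (s + 1) :=
      Or.inr ⟨f u, hfu, i, Or.inr (inv_mul_cancel_right _ _)⟩
    obtain ⟨u', hu', hfu'⟩ := hf.surjOn (ball_mono _ _ hs hx)
    have hE' : E i u' u := (hE i u' hu' u (ball_mono _ _ (by omega) hu)).2 (by
      rw [hfu']; exact inv_mul_cancel_right _ _)
    have hact : FreeGroup.lift (fun i => (σ i)⁻¹) (FreeGroup.of i) u = u' := by
      rw [FreeGroup.lift_apply_of, Equiv.Perm.inv_eq_iff_eq, hσ i u' u hE']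
    rw [hact, hfu', FreeGroup.lift_apply_of]
    exact ⟨Or.inr ⟨u, hu, i, Or.inr hE'⟩, hx, rfl⟩
  | inv_of i _ =>
    refine ⟨1, fun V E σ hσ v R f hf hE s hs u hu hfu => ?_⟩
    have hx : f u * g i ∈ ball (cayley g) 1 (s + 1) :=
      Or.inr ⟨f u, hfu, i, Or.inl rfl⟩
    obtain ⟨u', hu', hfu'⟩ := hf.surjOn (ball_mono _ _ hs hx)
    have hE' : E i u u' := (hE i u (ball_mono _ _ (by omega) hu) u' hu').2 (by
      rw [hfu']; rfl)
    have hact : FreeGroup.lift (fun i => (σ i)⁻¹) (FreeGroup.of i)⁻¹ u = u' := by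
      rw [map_inv, FreeGroup.lift_apply_of, inv_inv, hσ i u u' hE']
    rw [hact, hfu', map_inv, inv_inv, FreeGroup.lift_apply_of]
    exact ⟨Or.inr ⟨u, hu, i, Or.inl hE'⟩, hx, rfl⟩
  | mul x y hx hy =>
    obtain ⟨r, hx⟩ := hx
    obtain ⟨r', hy⟩ := hy
    refine ⟨r' + r, fun V E σ hσ v R f hf hE s hs u hu hfu => ?_⟩
    obtain ⟨h1, h2, h3⟩ := hy V E σ hσ v R f hf hE s (by omega) u hu hfu
    obtain ⟨h4, h5, h6⟩ := hx V E σ hσ v R f hf hE (s + r') (by omega) _ h1 h2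
    rw [map_mul, Equiv.Perm.mul_apply, ← add_assoc]
    refine ⟨h4, h5, ?_⟩
    rw [h6, h3, map_mul, mul_inv_rev, mul_assoc]

end SoficGroup

/-- Approximation of the relations between the elements `g i` of a group by permutations of finite
sets: for every finite set of words there are permutations under which the proportion of fixed
points of a word is close to `1` or `0` according as its value in the group is trivial or not. -/
def HasPermApprox {ι G : Type*} [Group G] (g : ι → G) : Prop :=
  ∀ (S : Finset (FreeGroup ι)) (ε : ℝ), 0 < ε →
    ∃ (V : Type) (_ : Finite V) (_ : Nonempty V) (φ : FreeGroup ι →* Equiv.Perm V),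
      ∀ w ∈ S, (FreeGroup.lift g w = 1 →
          (1 - ε) * Nat.card V ≤ ({v | φ w v = v}.ncard : ℝ)) ∧
        (FreeGroup.lift g w ≠ 1 → ({v | φ w v = v}.ncard : ℝ) ≤ ε * Nat.card V)

/-- The sofic approximations by labelled graphs give approximations by permutations. -/
theorem SoficGroup.IsSoficFG.exists_hasPermApprox {G : Type*} [Group G]
    (h : SoficGroup.IsSoficFG G) :
    ∃ (m : ℕ) (g : Fin m → G), Subgroup.closure (Set.range g) = ⊤ ∧ HasPermApprox g := by
  obtain ⟨m, g, -, hgen, h⟩ := h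
  refine ⟨m, g, hgen, fun S ε hε => ?_⟩
  choose r hr using SoficGroup.exists_radius_word_action g
  obtain ⟨V, hV, hne, E, hadm, hcard⟩ := h ε hε (S.sup r)
  choose σ hσ using fun i => exists_perm_extending (E i) (hadm.out_unique i) (hadm.in_unique i)
  have hgood : ∀ w ∈ S, ∀ v, SoficGroup.BallIso E v (SoficGroup.cayley g) 1 (S.sup r) →
      (FreeGroup.lift (fun i => (σ i)⁻¹) w v = v ↔ FreeGroup.lift g w = 1) := by
    rintro w hw v ⟨f, hfv, hf, hE⟩
    have hle : 0 + r w ≤ S.sup r := by rw [zero_add]; exact Finset.le_sup hw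
    obtain ⟨h1, -, h3⟩ := hr w V E σ hσ v _ f hf hE 0 hle v rfl hfv.symm
    constructor
    · intro h
      rw [h, eq_comm, mul_eq_left, inv_eq_one] at h3
      exact h3
    · intro h
      rw [h, inv_one, mul_one] at h3
      exact hf.injOn (SoficGroup.ball_mono _ _ hle h1) (SoficGroup.self_mem_ball _ _ _) h3
  refine ⟨V, hV, hne, FreeGroup.lift fun i => (σ i)⁻¹, fun w hw => ⟨fun h1 => ?_, fun h1 => ?_⟩⟩
  · refine hcard.trans ?_
    exact_mod_cast Set.ncard_le_ncard (fun v hv => (hgood w hw v hv).2 h1) (Set.toFinite _)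
  · have hsub : {v | FreeGroup.lift (fun i => (σ i)⁻¹) w v = v} ⊆
        {v | SoficGroup.BallIso E v (SoficGroup.cayley g) 1 (S.sup r)}ᶜ :=
      fun v hv hv' => h1 ((hgood w hw v hv').1 hv)
    have h2 := Set.ncard_le_ncard hsub (Set.toFinite _)
    have h3 := Set.ncard_add_ncard_compl
      {v | SoficGroup.BallIso E v (SoficGroup.cayley g) 1 (S.sup r)}
    have h2' := (Nat.cast_le (α := ℝ)).2 h2
    have h3' := congrArg (Nat.cast : ℕ → ℝ) h3
    push_cast at h3'
    linarith

/-- Passing to the subgroup generated by `s` when the group is not finitely generated, one finds in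
a sofic group finitely many elements generating a subgroup that contains a given finite set and
having approximations by permutations. -/
theorem IsSofic.exists_hasPermApprox {G : Type*} [Group G] (hG : IsSofic G) (s : Finset G) :
    ∃ (m : ℕ) (g : Fin m → G), (∀ x ∈ s, ∃ w, FreeGroup.lift g w = x) ∧ HasPermApprox g := by
  rcases hG with ⟨-, h⟩ | ⟨-, h⟩
  · obtain ⟨m, g, hgen, hg⟩ := h.exists_hasPermApprox
    refine ⟨m, g, fun x _ => ?_, hg⟩
    have hx : x ∈ (FreeGroup.lift g).range := by
      rw [FreeGroup.range_lift_eq_closure, hgen]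
      exact Subgroup.mem_top x
    exact hx
  · obtain ⟨m, g, hgen, hg⟩ := (h (Subgroup.closure s) ⟨s, rfl⟩).exists_hasPermApprox
    have hlift : ∀ w, FreeGroup.lift (fun i => (g i : G)) w = (FreeGroup.lift g w : G) := by
      intro w
      have : FreeGroup.lift (fun i => (g i : G)) =
          (Subgroup.closure (s : Set G)).subtype.comp (FreeGroup.lift g) := by
        ext i; simp
      rw [this]; rfl
    refine ⟨m, fun i => g i, fun x hx => ?_, fun S ε hε => ?_⟩
    · have hx' : (⟨x, Subgroup.subset_closure hx⟩ : Subgroup.closure (s : Set G)) ∈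
          (FreeGroup.lift g).range := by
        rw [FreeGroup.range_lift_eq_closure, hgen]
        exact Subgroup.mem_top _
      obtain ⟨w, hw⟩ := hx'
      exact ⟨w, by rw [hlift, hw]⟩
    · obtain ⟨V, hV, hne, φ, hφ⟩ := hg S ε hε
      refine ⟨V, hV, hne, φ, fun w hw => ?_⟩
      rw [hlift, Ne, OneMemClass.coe_eq_one]
      exact hφ w hw

/-! ### Spectral measures of positive contractions -/

section SpectralMeasure

variable {H : Type*} [NormedAddCommGroup H] [InnerProductSpace ℂ H] [CompleteSpace H]

instance isFiniteMeasure_spectralMeasure (T : H →L[ℂ] H) (hT : IsSelfAdjoint T) (ξ : H) :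
    IsFiniteMeasure (spectralMeasure T hT ξ) := by
  unfold spectralMeasure
  infer_instance

theorem ae_spectralMeasure_mem_spectrum (T : H →L[ℂ] H) (hT : IsSelfAdjoint T) (ξ : H) :
    ∀ᵐ x ∂spectralMeasure T hT ξ, x ∈ spectrum ℝ T := by
  have hm : MeasurableSet (spectrum ℝ T) := (spectrum.isCompact T).isClosed.measurableSet
  exact (ae_map_iff (p := (· ∈ spectrum ℝ T)) measurable_subtype_coe.aemeasurable hm).2
    (Filter.Eventually.of_forall fun x => x.2)

/-- The moments of the spectral measure. -/
theorem integral_polynomial_spectralMeasure (T : H →L[ℂ] H) (hT : IsSelfAdjoint T) (ξ : H)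
    (p : Polynomial ℝ) :
    ∫ x, p.eval x ∂spectralMeasure T hT ξ = (⟪ξ, Polynomial.aeval T p ξ⟫_ℂ).re := by
  have hm : MeasurableSet (spectrum ℝ T) := (spectrum.isCompact T).isClosed.measurableSet
  let f : C_c(spectrum ℝ T, ℝ) :=
    ⟨⟨_, p.continuous.continuousOn.domRestrict⟩, HasCompactSupport.of_compactSpace _⟩
  rw [spectralMeasure, (MeasurableEmbedding.subtype_coe hm).integral_map]
  have h := RealRMK.integral_rieszMeasure (spectralFunctional T hT ξ) f
  refine Eq.trans h ?_
  change (⟪ξ, cfcHom hT f.toContinuousMap ξ⟫_ℂ).re = _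
  rw [← cfc_polynomial p T hT, cfc_apply _ T hT p.continuous.continuousOn]

theorem integral_one_sub_pow_spectralMeasure (T : H →L[ℂ] H) (hT : IsSelfAdjoint T) (ξ : H)
    (k : ℕ) : ∫ x, (1 - x) ^ k ∂spectralMeasure T hT ξ = (⟪ξ, ((1 - T) ^ k) ξ⟫_ℂ).re := by
  have h := integral_polynomial_spectralMeasure T hT ξ ((1 - Polynomial.X) ^ k)
  simpa using h

theorem integral_one_sub_sq_pow_spectralMeasure (T : H →L[ℂ] H) (hT : IsSelfAdjoint T) (ξ : H)
    (k : ℕ) : ∫ x, (1 - x ^ 2) ^ k ∂spectralMeasure T hT ξ =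
      (⟪ξ, ((1 - T ^ 2) ^ k : H →L[ℂ] H) ξ⟫_ℂ).re := by
  have h := integral_polynomial_spectralMeasure T hT ξ ((1 - Polynomial.X ^ 2) ^ k)
  simpa using h

theorem ae_spectralMeasure_mem_Icc {T : H →L[ℂ] H} (hT : IsSelfAdjoint T) (hpos : T.IsPositive)
    (hnorm : ‖T‖ ≤ 1) (ξ : H) : ∀ᵐ x ∂spectralMeasure T hT ξ, x ∈ Set.Icc (0 : ℝ) 1 := by
  filter_upwards [ae_spectralMeasure_mem_spectrum T hT ξ] with x hx
  refine ⟨SpectrumRestricts.nnreal_iff.1 hpos.spectrumRestricts x hx, ?_⟩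
  calc x ≤ ‖x‖ := Real.le_norm_self x
    _ ≤ ‖T‖ * ‖(1 : H →L[ℂ] H)‖ := spectrum.norm_le_norm_mul_of_mem hx
    _ ≤ 1 := mul_le_one₀ hnorm (norm_nonneg _) ContinuousLinearMap.norm_id_le

end SpectralMeasure

section Moments

variable {μ : Measure ℝ}

theorem ae_one_sub_mem_Icc (h : ∀ᵐ x ∂μ, x ∈ Set.Icc (0 : ℝ) 1) :
    ∀ᵐ x ∂μ, 1 - x ∈ Set.Icc (0 : ℝ) 1 := by
  filter_upwards [h] with x hx
  exact ⟨by linarith [hx.2], by linarith [hx.1]⟩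

theorem ae_one_sub_sq_mem_Icc (h : ∀ᵐ x ∂μ, x ∈ Set.Icc (0 : ℝ) 1) :
    ∀ᵐ x ∂μ, 1 - x ^ 2 ∈ Set.Icc (0 : ℝ) 1 := by
  filter_upwards [h] with x hx
  have := pow_le_one₀ (n := 2) hx.1 hx.2
  exact ⟨by linarith, by linarith [sq_nonneg x]⟩

variable [IsFiniteMeasure μ]

theorem integrable_pow_of_ae_mem_Icc {f : ℝ → ℝ} (hf : Continuous f)
    (h : ∀ᵐ x ∂μ, f x ∈ Set.Icc (0 : ℝ) 1) (n : ℕ) : Integrable (fun x => f x ^ n) μ := by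
  refine Integrable.of_bound (hf.pow n).aestronglyMeasurable 1 ?_
  filter_upwards [h] with x hx
  rw [Real.norm_of_nonneg (pow_nonneg hx.1 n)]
  exact pow_le_one₀ hx.1 hx.2

theorem measureReal_zero_le_integral_one_sub_pow (h : ∀ᵐ x ∂μ, x ∈ Set.Icc (0 : ℝ) 1) (n : ℕ) :
    μ.real {0} ≤ ∫ x, (1 - x) ^ n ∂μ := by
  rw [← integral_indicator_one (measurableSet_singleton 0)]
  refine integral_mono_ae ((integrable_const 1).indicator (measurableSet_singleton 0))
    (integrable_pow_of_ae_mem_Icc (by fun_prop) (ae_one_sub_mem_Icc h) n) ?_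
  filter_upwards [h] with x hx
  by_cases hx0 : x = 0
  · simp [hx0]
  · simpa [hx0] using pow_nonneg (by linarith [hx.2]) n

theorem integral_one_sub_pow_le (h : ∀ᵐ x ∂μ, x ∈ Set.Icc (0 : ℝ) 1) (n : ℕ) :
    ∫ x, (1 - x) ^ n ∂μ ≤ ∫ x, (1 - x ^ 2) ^ n ∂μ := by
  refine integral_mono_ae
    (integrable_pow_of_ae_mem_Icc (by fun_prop) (ae_one_sub_mem_Icc h) n)
    (integrable_pow_of_ae_mem_Icc (by fun_prop) (ae_one_sub_sq_mem_Icc h) n) ?_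
  filter_upwards [h] with x hx
  exact pow_le_pow_left₀ (by linarith [hx.2]) (by nlinarith [hx.1, hx.2]) n

theorem tendsto_integral_one_sub_sq_pow (h : ∀ᵐ x ∂μ, x ∈ Set.Icc (0 : ℝ) 1) :
    Filter.Tendsto (fun k : ℕ => ∫ x, (1 - x ^ 2) ^ k ∂μ) Filter.atTop (nhds (μ.real {0})) := by
  rw [← integral_indicator_one (measurableSet_singleton 0)]
  refine tendsto_integral_of_dominated_convergence (fun _ => 1)
    (fun k => Continuous.aestronglyMeasurable (by fun_prop)) (integrable_const 1) (fun k => ?_) ?_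
  · filter_upwards [ae_one_sub_sq_mem_Icc h] with x hx
    rw [Real.norm_of_nonneg (pow_nonneg hx.1 k)]
    exact pow_le_one₀ hx.1 hx.2
  · filter_upwards [h, ae_one_sub_sq_mem_Icc h] with x hx hx2
    by_cases hx0 : x = 0
    · simp [hx0]
    · have hpos : 0 < x ^ 2 := by positivity
      simpa [hx0] using tendsto_pow_atTop_nhds_zero_of_lt_one hx2.1 (by linarith)

end Moments

/-! ### The rational group ring acting on `ℓ²(G)` -/

/-- The norm of the image of a rational group ring element under a representation by contractions
is at most the `ℓ¹`-norm. -/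
theorem norm_monoidAlgebra_lift_le {G A : Type*} [Monoid G] [NormedRing A] [NormedAlgebra ℝ A]
    [Algebra ℚ A] (ρ : G →* A) (hρ : ∀ g, ‖ρ g‖ ≤ 1) (T : MonoidAlgebra ℚ G) :
    ‖MonoidAlgebra.lift ℚ A G ρ T‖ ≤ ((∑ g ∈ T.coeff.support, |T.coeff g| : ℚ) : ℝ) := by
  rw [MonoidAlgebra.lift_apply, Finsupp.sum, Rat.cast_sum]
  refine norm_sum_le_of_le _ fun g _ => ?_
  rw [← Rat.cast_smul_eq_qsmul ℝ, norm_smul, Rat.cast_abs, Real.norm_eq_abs]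
  exact mul_le_of_le_one_right (abs_nonneg _) (hρ g)

section GroupRing

variable {G : Type*} [Group G]

theorem ratGroupRingOp_eq_lift (T : MonoidAlgebra ℚ G) :
    ratGroupRingOp T = MonoidAlgebra.lift ℚ (L2 G →L[ℂ] L2 G) G (leftRegular G) T :=
  MonoidAlgebra.lift_mapRingHom_algebraMap _ _

theorem leftRegular_single (g : G) (ζ : L2 G) (h : G) : leftRegular G g ζ h = ζ (g⁻¹ * h) := rfl

theorem inner_leftRegular_leftRegular (g : G) (ζ ξ : L2 G) :
    ⟪leftRegular G g ζ, leftRegular G g ξ⟫_ℂ = ⟪ζ, ξ⟫_ℂ :=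
  (leftTranslation g).inner_map_map ζ ξ

theorem norm_leftRegular_le (g : G) : ‖leftRegular G g‖ ≤ 1 :=
  (leftTranslation g).norm_toContinuousLinearMap_le

theorem norm_ratGroupRingOp_le (T : MonoidAlgebra ℚ G) :
    ‖ratGroupRingOp T‖ ≤ ((∑ g ∈ T.coeff.support, |T.coeff g| : ℚ) : ℝ) := by
  rw [ratGroupRingOp_eq_lift]
  exact norm_monoidAlgebra_lift_le _ norm_leftRegular_le T

/-- The von Neumann trace of a group ring element is its coefficient at the neutral element. -/
theorem vnTrace_ratGroupRingOp (T : MonoidAlgebra ℚ G) :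
    vnTrace (ratGroupRingOp T) = ((T.coeff 1 : ℚ) : ℂ) := by
  classical
  rw [ratGroupRingOp_eq_lift, vnTrace]
  induction T using MonoidAlgebra.induction with
  | zero => simp
  | single_add g a T _ _ ih =>
    rw [map_add, add_apply, inner_add_right, ih, MonoidAlgebra.coeff_add, Finsupp.add_apply,
      Rat.cast_add, MonoidAlgebra.lift_single, ← Rat.cast_smul_eq_qsmul ℂ, smul_apply,
      inner_smul_right]
    congr 1
    have hz : ∀ f : L2 G, ⟪zetaOne G, f⟫_ℂ = f 1 := by
      intro f
      have := lp.inner_single_left (𝕜 := ℂ) (G := fun _ : G => ℂ) 1 (1 : ℂ) f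
      rw [zetaOne]
      convert this using 1
      · simp
    rw [hz, leftRegular_single, zetaOne, lp.single_apply, MonoidAlgebra.coeff_single,
      Finsupp.single_apply, Pi.single_apply]
    by_cases hg : g = 1 <;> simp [hg]

/-- The coefficients of a group ring element acting as a self-adjoint operator are symmetric. -/
theorem coeff_inv_of_isSelfAdjoint {T : MonoidAlgebra ℚ G}
    (hT : IsSelfAdjoint (ratGroupRingOp T)) (g : G) : T.coeff g⁻¹ = T.coeff g := by
  have h1 : vnTrace (ratGroupRingOp (MonoidAlgebra.single g⁻¹ 1 * T)) = ((T.coeff g : ℚ) : ℂ) := by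
    rw [vnTrace_ratGroupRingOp, MonoidAlgebra.coeff_single_mul_apply]
    simp
  have h2 : vnTrace (ratGroupRingOp (T * MonoidAlgebra.single g 1)) = ((T.coeff g⁻¹ : ℚ) : ℂ) := by
    rw [vnTrace_ratGroupRingOp, MonoidAlgebra.coeff_mul_single_apply]
    simp
  have h3 : vnTrace (ratGroupRingOp (MonoidAlgebra.single g⁻¹ 1 * T)) =
      starRingEnd ℂ (vnTrace (ratGroupRingOp (T * MonoidAlgebra.single g 1))) := by
    have hT' := ContinuousLinearMap.isSelfAdjoint_iff_isSymmetric.1 hT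
    rw [ratGroupRingOp_eq_lift, ratGroupRingOp_eq_lift, map_mul, map_mul,
      MonoidAlgebra.lift_single, MonoidAlgebra.lift_single, one_smul, one_smul,
      ← ratGroupRingOp_eq_lift, vnTrace, vnTrace, inner_conj_symm]
    change ⟪zetaOne G, leftRegular G g⁻¹ (ratGroupRingOp T (zetaOne G))⟫_ℂ =
      ⟪ratGroupRingOp T (leftRegular G g (zetaOne G)), zetaOne G⟫_ℂ
    have h4 := hT' (leftRegular G g (zetaOne G)) (zetaOne G)
    refine Eq.trans ?_ h4.symm
    rw [← inner_leftRegular_leftRegular g]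
    congr 1
    change (leftRegular G g * leftRegular G g⁻¹) (ratGroupRingOp T (zetaOne G)) = _
    rw [← map_mul, mul_inv_cancel, map_one]
    rfl
  rw [h1, h2, map_ratCast] at h3
  exact_mod_cast h3.symm

end GroupRing

/-! ### Permutation matrices and the trace of the group ring -/

/-- The linear extension to the rational group ring of the permutation matrices of an action. -/
noncomputable def permMatrixRep {F V : Type*} [Group F] [Fintype V] [DecidableEq V]
    (φ : F →* Equiv.Perm V) : MonoidAlgebra ℚ F →ₐ[ℚ] Matrix V V ℝ :=
  MonoidAlgebra.lift ℚ (Matrix V V ℝ) F (Matrix.permMatrixHom.comp φ)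

section PermMatrixRep

variable {F V : Type*} [Group F] [Fintype V] [DecidableEq V]

theorem permMatrixRep_single (φ : F →* Equiv.Perm V) (w : F) (a : ℚ) :
    permMatrixRep φ (MonoidAlgebra.single w a) = (a : ℝ) • (φ w)⁻¹.permMatrix ℝ := by
  rw [permMatrixRep, MonoidAlgebra.lift_single, ← Rat.cast_smul_eq_qsmul ℝ]
  rfl

theorem trace_permMatrixRep (φ : F →* Equiv.Perm V) (Y : MonoidAlgebra ℚ F) :
    (permMatrixRep φ Y).trace =
      ∑ w ∈ Y.coeff.support, (Y.coeff w : ℝ) * ({v | φ w v = v}.ncard : ℝ) := by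
  rw [permMatrixRep, MonoidAlgebra.lift_apply, Finsupp.sum, Matrix.trace_sum]
  refine Finset.sum_congr rfl fun w _ => ?_
  rw [← Rat.cast_smul_eq_qsmul ℝ, Matrix.trace_smul, smul_eq_mul]
  change _ * ((φ w)⁻¹.permMatrix ℝ).trace = _
  rw [Matrix.trace_permutation]
  congr 3
  ext v
  exact Equiv.Perm.inv_eq_iff_eq.trans eq_comm

end PermMatrixRep

/-- The normalised traces of the permutation matrices approximate the trace of the group ring. -/
theorem HasPermApprox.exists_coeff_one_le {ι G : Type*} [Group G] {g : ι → G}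
    (hg : HasPermApprox g) (Y : MonoidAlgebra ℚ (FreeGroup ι)) {δ : ℝ} (hδ : 0 < δ) :
    ∃ (V : Type) (_ : Fintype V) (_ : DecidableEq V) (_ : Nonempty V)
      (φ : FreeGroup ι →* Equiv.Perm V),
      ((MonoidAlgebra.mapDomainAlgHom ℚ ℚ (FreeGroup.lift g) Y).coeff 1 : ℝ) * Fintype.card V ≤
        (permMatrixRep φ Y).trace + δ * Fintype.card V := by
  classical
  set K : ℝ := ∑ w ∈ Y.coeff.support, |(Y.coeff w : ℝ)| with hK
  have hK0 : 0 ≤ K := Finset.sum_nonneg fun _ _ => abs_nonneg _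
  obtain ⟨V, hV, hne, φ, hφ⟩ := hg Y.coeff.support (δ / (1 + K)) (by positivity)
  have : Fintype V := Fintype.ofFinite V
  refine ⟨V, this, inferInstance, hne, φ, ?_⟩
  rw [Nat.card_eq_fintype_card] at hφ
  set N : ℝ := (Fintype.card V : ℝ)
  have hN : 0 ≤ N := Nat.cast_nonneg _
  set ε := δ / (1 + K) with hε
  have hε0 : 0 < ε := by positivity
  have hcoeff : ((MonoidAlgebra.mapDomainAlgHom ℚ ℚ (FreeGroup.lift g) Y).coeff 1 : ℝ) =
      ∑ w ∈ Y.coeff.support, (Y.coeff w : ℝ) * (if FreeGroup.lift g w = 1 then 1 else 0) := by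
    change ((Finsupp.mapDomain (FreeGroup.lift g) Y.coeff 1 : ℚ) : ℝ) = _
    rw [Finsupp.mapDomain, Finsupp.sum_apply, Finsupp.sum, Rat.cast_sum]
    refine Finset.sum_congr rfl fun w _ => ?_
    rw [Finsupp.single_apply]
    split_ifs <;> simp
  have hterm : ∀ w ∈ Y.coeff.support,
      (Y.coeff w : ℝ) * (if FreeGroup.lift g w = 1 then 1 else 0) * N ≤
        (Y.coeff w : ℝ) * ({v | φ w v = v}.ncard : ℝ) + |(Y.coeff w : ℝ)| * (ε * N) := by
    intro w hw
    have hfix : |(if FreeGroup.lift g w = 1 then 1 else 0) * N - ({v | φ w v = v}.ncard : ℝ)| ≤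
        ε * N := by
      have hle : ({v | φ w v = v}.ncard : ℝ) ≤ N := by
        have := Set.ncard_le_ncard (Set.subset_univ {v | φ w v = v}) (Set.toFinite _)
        rw [Set.ncard_univ, Nat.card_eq_fintype_card] at this
        exact Nat.cast_le.2 this
      have h0 : (0 : ℝ) ≤ ({v | φ w v = v}.ncard : ℝ) := Nat.cast_nonneg _
      have hεN : 0 ≤ ε * N := by positivity
      rw [abs_le]
      split_ifs with h
      · have := (hφ w hw).1 h
        constructor <;> linarith
      · have := (hφ w hw).2 h
        constructor <;> linarith
    have h1 := le_abs_self ((Y.coeff w : ℝ) *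
      ((if FreeGroup.lift g w = 1 then 1 else 0) * N - ({v | φ w v = v}.ncard : ℝ)))
    rw [abs_mul] at h1
    have h2 := mul_le_mul_of_nonneg_left hfix (abs_nonneg (Y.coeff w : ℝ))
    linarith
  have hsum := Finset.sum_le_sum hterm
  rw [Finset.sum_add_distrib, ← Finset.sum_mul, ← Finset.sum_mul, ← hcoeff,
    ← trace_permMatrixRep, ← hK] at hsum
  have hKε : K * ε ≤ δ := by
    rw [hε, ← mul_div_assoc, div_le_iff₀ (by positivity)]
    nlinarith
  have := mul_le_mul_of_nonneg_right hKε hN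
  linarith

section Denominators

variable {G : Type*}

theorem one_le_lcmDenominators (T : MonoidAlgebra ℚ G) : 1 ≤ lcmDenominators T := by
  rw [Nat.one_le_iff_ne_zero, lcmDenominators, Ne, Finset.lcm_eq_zero_iff]
  rintro ⟨g, -, hg⟩
  exact (T.coeff g).den_nz hg

theorem exists_int_eq_lcmDenominators_mul (T : MonoidAlgebra ℚ G) (g : G) :
    ∃ b : ℤ, (b : ℚ) = lcmDenominators T * T.coeff g := by
  have hdvd : (T.coeff g).den ∣ lcmDenominators T := by
    by_cases hg : g ∈ T.coeff.support
    · exact Finset.dvd_lcm (f := fun g => (T.coeff g).den) hg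
    · rw [Finsupp.notMem_support_iff.1 hg]
      exact one_dvd _
  obtain ⟨c, hc⟩ := hdvd
  refine ⟨c * (T.coeff g).num, ?_⟩
  rw [hc]
  push_cast
  rw [mul_right_comm, Rat.den_mul_eq_num, mul_comm]

end Denominators

open scoped Matrix Matrix.Norms.L2Operator in
/-- The estimate on spectra near zero, for moments of the spectral measure: as `k → ∞` the left-hand
side tends to the integral of `(1 - x ^ 2) ^ n` over the complement of `{0}`. It passes to the limit
from `Matrix.trace_one_sub_transpose_mul_pow_sub_le`, applied to the matrices by which a lift of `T`
to the free group acts on the finite approximations. -/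
theorem IsSofic.coeff_one_sub_sq_pow_sub_le {G : Type*} [Group G] (hG : IsSofic G)
    {T : MonoidAlgebra ℚ G} (hT : ∀ g, T.coeff g⁻¹ = T.coeff g)
    (hsum : ∑ g ∈ T.coeff.support, |T.coeff g| ≤ 1) {η : ℝ} (hη : 0 < η) (hη1 : η < 1) (n k : ℕ) :
    ((((1 - T ^ 2) ^ n - (1 - T ^ 2) ^ k).coeff 1 : ℚ) : ℝ) ≤
      -2 * Real.log (lcmDenominators T) / Real.log η + (1 - η) ^ n := by
  obtain ⟨m, g, hg, happ⟩ := hG.exists_hasPermApprox T.coeff.support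
  choose! w hw using hg
  choose b hb using exists_int_eq_lcmDenominators_mul T
  -- `T₁` is a lift of `T` to the free group, `T₂` is its adjoint, which is also a lift of `T`.
  set T₁ : MonoidAlgebra ℚ (FreeGroup (Fin m)) :=
    ∑ x ∈ T.coeff.support, MonoidAlgebra.single (w x) (T.coeff x) with hT₁
  set T₂ : MonoidAlgebra ℚ (FreeGroup (Fin m)) :=
    ∑ x ∈ T.coeff.support, MonoidAlgebra.single (w x)⁻¹ (T.coeff x) with hT₂
  set π := MonoidAlgebra.mapDomainAlgHom ℚ ℚ (FreeGroup.lift g) with hπ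
  have hπs : ∀ u a, π (MonoidAlgebra.single u a) = MonoidAlgebra.single (FreeGroup.lift g u) a :=
    fun u a => MonoidAlgebra.mapDomain_single
  have hπ1 : π T₁ = T := by
    rw [hT₁, map_sum]
    conv_rhs => rw [← MonoidAlgebra.sum_coeff_single T]
    exact Finset.sum_congr rfl fun x hx => by rw [hπs, hw x hx]
  have hπ2 : π T₂ = T := by
    rw [hT₂, map_sum]
    conv_rhs => rw [← MonoidAlgebra.sum_coeff_single T]
    refine Finset.sum_bij' (fun x _ => x⁻¹) (fun x _ => x⁻¹) ?_ ?_ ?_ ?_ ?_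
    · intro x hx; simpa [hT] using hx
    · intro x hx; simpa [hT] using hx
    · simp
    · simp
    · intro x hx; rw [hπs, map_inv, hw x hx, hT]
  set Y := (1 - T₂ * T₁) ^ n - (1 - T₂ * T₁) ^ k with hY
  have hπY : π Y = (1 - T ^ 2) ^ n - (1 - T ^ 2) ^ k := by
    rw [hY, map_sub, map_pow, map_pow, map_sub, map_one, map_mul, hπ1, hπ2, sq]
  refine le_of_forall_pos_le_add fun δ hδ => ?_
  obtain ⟨V, _, _, hne, φ, hφ⟩ := happ.exists_coeff_one_le Y hδ
  rw [← hπ, hπY] at hφ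
  set Z : Matrix V V ℤ := ∑ x ∈ T.coeff.support, b x • (φ (w x))⁻¹.permMatrix ℤ with hZ
  have hC : (1 : ℝ) ≤ lcmDenominators T := by exact_mod_cast one_le_lcmDenominators T
  have hperm : ∀ σ : Equiv.Perm V, (σ.permMatrix ℤ).map (Int.cast : ℤ → ℝ) = σ.permMatrix ℝ := by
    intro σ
    ext i j
    simp [Equiv.Perm.permMatrix, PEquiv.toMatrix_apply]
  have hA1 : permMatrixRep φ T₁ =
      (lcmDenominators T : ℝ)⁻¹ • Z.map (Int.cast : ℤ → ℝ) := by
    have hmap : Z.map (Int.cast : ℤ → ℝ) =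
        ∑ x ∈ T.coeff.support, (b x : ℝ) • (φ (w x))⁻¹.permMatrix ℝ := by
      change (Int.castRingHom ℝ).mapMatrix Z = _
      rw [hZ, map_sum]
      refine Finset.sum_congr rfl fun x _ => ?_
      rw [map_zsmul, ← Int.cast_smul_eq_zsmul ℝ]
      congr 1
      exact hperm _
    rw [hmap, hT₁, map_sum, Finset.smul_sum]
    refine Finset.sum_congr rfl fun x _ => ?_
    rw [permMatrixRep_single, smul_smul]
    congr 1
    have : (b x : ℝ) = lcmDenominators T * T.coeff x := by
      exact_mod_cast congrArg (Rat.cast : ℚ → ℝ) (hb x)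
    rw [this, inv_mul_cancel_left₀ (by positivity)]
  have hA2 : permMatrixRep φ T₂ = (permMatrixRep φ T₁)ᵀ := by
    rw [hT₁, hT₂, map_sum, map_sum, Matrix.transpose_sum]
    refine Finset.sum_congr rfl fun x _ => ?_
    rw [permMatrixRep_single, permMatrixRep_single, Matrix.transpose_smul,
      Matrix.transpose_permMatrix, map_inv]
  have hnorm : ‖permMatrixRep φ T₁‖ ≤ 1 := by
    rw [hT₁, map_sum]
    refine (norm_sum_le_of_le (n := fun x => |(T.coeff x : ℝ)|) _ fun x _ => ?_).trans ?_
    · rw [permMatrixRep_single, norm_smul, Real.norm_eq_abs]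
      exact mul_le_of_le_one_right (abs_nonneg _) (Matrix.permMatrix_l2_opNorm_le _)
    · exact_mod_cast hsum
  have hfin := Matrix.trace_one_sub_transpose_mul_pow_sub_le Z hC hA1 hnorm hη hη1 n k
  have htr : permMatrixRep φ Y = (1 - (permMatrixRep φ T₁)ᵀ * permMatrixRep φ T₁) ^ n -
      (1 - (permMatrixRep φ T₁)ᵀ * permMatrixRep φ T₁) ^ k := by
    rw [hY, map_sub, map_pow, map_pow, map_sub, map_one, map_mul, hA2]
  rw [htr] at hφ
  have hN : (0 : ℝ) < Fintype.card V := by exact_mod_cast Fintype.card_pos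
  refine le_of_mul_le_mul_right ?_ hN
  linarith

/-! ### The bound on the spectral measure -/

/-- The numerical estimate: the threshold `η = n ^ (-2 / 3)` makes the first summand equal to
`3 log C / log n`, and the second one is at most `exp (-n ^ (1 / 3)) < 3 / log n`. -/
theorem exists_threshold_bound_lt {C : ℝ} (hC : 1 ≤ C) {n : ℕ} (hn : 2 ≤ n) :
    ∃ η : ℝ, 0 < η ∧ η < 1 ∧
      -2 * Real.log C / Real.log η + (1 - η) ^ n < 3 * C / Real.log n := by
  have hn1 : (1 : ℝ) < n := by exact_mod_cast hn
  have hn0 : (0 : ℝ) < n := by linarith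
  have hL : 0 < Real.log n := Real.log_pos hn1
  refine ⟨(n : ℝ) ^ (-(2 / 3) : ℝ), Real.rpow_pos_of_pos hn0 _,
    Real.rpow_lt_one_of_one_lt_of_neg hn1 (by norm_num), ?_⟩
  set η : ℝ := (n : ℝ) ^ (-(2 / 3) : ℝ) with hη
  have hη1 : η < 1 := Real.rpow_lt_one_of_one_lt_of_neg hn1 (by norm_num)
  set y : ℝ := (n : ℝ) ^ (1 / 3 : ℝ) with hy
  have hy0 : 0 < y := Real.rpow_pos_of_pos hn0 _
  have hlog : Real.log η = -(2 / 3) * Real.log n := Real.log_rpow hn0 _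
  have hlogy : Real.log n = 3 * Real.log y := by rw [hy, Real.log_rpow hn0]; ring
  have hηn : η * n = y := by
    rw [hη, hy]
    nth_rewrite 2 [← Real.rpow_one (n : ℝ)]
    rw [← Real.rpow_add hn0]
    norm_num
  have h1 : -2 * Real.log C / Real.log η = 3 * Real.log C / Real.log n := by
    rw [hlog]
    field_simp
  have h2 : (1 - η) ^ n ≤ Real.exp (-y) := by
    calc (1 - η) ^ n ≤ (Real.exp (-η)) ^ n :=
          pow_le_pow_left₀ (by linarith) (Real.one_sub_le_exp_neg η) n
      _ = Real.exp (-y) := by rw [← Real.exp_nat_mul, ← hηn]; congr 1; ring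
  have h3 : Real.exp (-y) < 3 / Real.log n := by
    rw [lt_div_iff₀ hL, hlogy, Real.exp_neg, inv_mul_lt_iff₀ (Real.exp_pos y)]
    have := Real.log_le_sub_one_of_pos hy0
    have := Real.add_one_le_exp y
    linarith
  have h4 : 3 * Real.log C / Real.log n + 3 / Real.log n ≤ 3 * C / Real.log n := by
    rw [← add_div]
    have := Real.log_le_sub_one_of_pos (show 0 < C by linarith)
    gcongr
    linarith
  linarith

theorem mainTheorem6 {G : Type*} [Group G] (hG : IsSofic G) (T : MonoidAlgebra ℚ G)
    (hsa : IsSelfAdjoint (ratGroupRingOp T)) (hpos : (ratGroupRingOp T).IsPositive)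
    (hsum : ∑ g ∈ T.coeff.support, |T.coeff g| < 1) (n : ℕ) (hn : 2 ≤ n) :
    ‖vnTrace ((1 - ratGroupRingOp T) ^ n) -
        (((vnSpectralMeasure (ratGroupRingOp T) hsa).real {0} : ℝ) : ℂ)‖ <
      3 * (lcmDenominators T : ℝ) / Real.log n := by
  set A := ratGroupRingOp T with hA
  have : IsFiniteMeasure (vnSpectralMeasure A hsa) := isFiniteMeasure_spectralMeasure _ _ _
  set μ := vnSpectralMeasure A hsa with hμ
  have hnorm : ‖A‖ ≤ 1 := (norm_ratGroupRingOp_le T).trans (by exact_mod_cast hsum.le)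
  have hsupp : ∀ᵐ x ∂μ, x ∈ Set.Icc (0 : ℝ) 1 := ae_spectralMeasure_mem_Icc hsa hpos hnorm _
  have hone : (1 - A) ^ n = ratGroupRingOp ((1 - T) ^ n) := by
    rw [hA, ratGroupRingOp_eq_lift, ratGroupRingOp_eq_lift, map_pow, map_sub, map_one]
  have hsq : ∀ k : ℕ, ∫ x, (1 - x ^ 2) ^ k ∂μ = ((((1 - T ^ 2) ^ k).coeff 1 : ℚ) : ℝ) := by
    intro k
    have hop : (1 - A ^ 2) ^ k = ratGroupRingOp ((1 - T ^ 2) ^ k) := by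
      rw [hA, ratGroupRingOp_eq_lift, ratGroupRingOp_eq_lift, map_pow, map_sub, map_one, map_pow]
    rw [hμ, vnSpectralMeasure, integral_one_sub_sq_pow_spectralMeasure, hop]
    change (vnTrace (ratGroupRingOp _)).re = _
    rw [vnTrace_ratGroupRingOp, Complex.ratCast_re]
  have htr : vnTrace ((1 - A) ^ n) = ((∫ x, (1 - x) ^ n ∂μ : ℝ) : ℂ) := by
    rw [hμ, vnSpectralMeasure, integral_one_sub_pow_spectralMeasure, hone]
    change _ = (((vnTrace (ratGroupRingOp _)).re : ℝ) : ℂ)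
    rw [vnTrace_ratGroupRingOp, Complex.ratCast_re, Complex.ofReal_ratCast]
  obtain ⟨η, hη, hη1, hlt⟩ := exists_threshold_bound_lt (C := (lcmDenominators T : ℝ))
    (by exact_mod_cast one_le_lcmDenominators T) hn
  have hlim : ∫ x, (1 - x ^ 2) ^ n ∂μ - μ.real {0} ≤
      -2 * Real.log (lcmDenominators T) / Real.log η + (1 - η) ^ n := by
    refine le_of_tendsto ((tendsto_integral_one_sub_sq_pow hsupp).const_sub _)
      (Filter.Eventually.of_forall fun k => ?_)
    have h := hG.coeff_one_sub_sq_pow_sub_le (coeff_inv_of_isSelfAdjoint hsa) hsum.le hη hη1 n k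
    rw [MonoidAlgebra.coeff_sub, Finsupp.sub_apply, Rat.cast_sub] at h
    rwa [hsq, hsq]
  rw [htr, ← Complex.ofReal_sub, Complex.norm_real, Real.norm_of_nonneg
    (sub_nonneg.2 (measureReal_zero_le_integral_one_sub_pow hsupp n))]
  linarith [integral_one_sub_pow_le hsupp n]
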